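/- Let $1<l<2$ and $1\le p\le\infty$. Let $C_{p,l}$ be the space of functions $f:\mathbb{R}\to\mathbb{C}$ with $(1+|x|^{l})f\in L^1(\mathbb{R})$ whose weak (distributional) derivative $f'$ belongs to $L^p(\mathbb{R})$. For a phase $\gamma:\mathbb{R}\times\mathbb{R}\to\mathbb{R}$ define the oscillatory maximal function $$M_\gamma f(x)=\sup_{r>0}\frac1{2r}\left|\int_{-r}^{r}f(x-t)\,e^{i\gamma(x,t)}\,dt\right|.$$ Suppose that one of the following two conditions holds. 1. $\gamma(x,t)=\sum_{j=1}^m c_j(x)|t|^{d_j}$ with $m\ge 1$, real exponents $2\le d_1<d_2<\dots<d_m$, $d_m>2$, and real-valued measurable $c_1,\dots,c_m$ such that $c_1,\dots,c_{m}\in L^\infty(\mathbb{R})$, $c_m\ne0$ almost everywhere and $1/c_m\in L^\infty(\mathbb{R})$. 2. $\gamma(x,t)=a(x)t^2$ with a real-valued measurable function $a$ such that $a\in L^\infty(\mathbb{R})$, $a\neq 0$ almost everywhere, $1/a\in L^\infty(\mathbb{R})$, and $p<\infty$. Then $M_\gamma$ is bounded from $C_{p,l}$ into $L^1(\mathbb{R})$: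 there is a constant $C$, depending only on $p$, $l$ and $\gamma$, such that for all $f\in C_{p,l}$ one has $M_\gamma f\in L^1(\mathbb{R})$ and $$\|M_\gamma f\|_1\le C\left(\|(1+|x|^{l})f\|_1+\|f'\|_p\right).$$ -/

import Mathlib

open MeasureTheory
open scoped ENNReal NNReal

noncomputable section

/-- The oscillatory maximal function
`M_γ f (x) = sup_{r > 0} (1 / (2 r)) |∫_{-r}^{r} f (x - t) e^{i γ(x, t)} dt|`, with values in
`[0, ∞]`. -/
def oscMaximal (γ : ℝ → ℝ → ℝ) (f : ℝ → ℂ) (x : ℝ) : ℝ≥0∞ :=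
  ⨆ (r : ℝ) (_ : 0 < r),
    ENNReal.ofReal (1 / (2 * r)) *
      ‖∫ t in (-r)..r, f (x - t) * Complex.exp (Complex.I * (γ x t : ℂ))‖ₑ

/-- `f'` is a weak (distributional) derivative of `f` on the real line. -/
structure HasWeakDeriv (f f' : ℝ → ℂ) : Prop where
  locallyIntegrable : LocallyIntegrable f volume
  locallyIntegrable_deriv : LocallyIntegrable f' volume
  integral_eq : ∀ φ : ℝ → ℝ, ContDiff ℝ (⊤ : ℕ∞) φ → HasCompactSupport φ →
    ∫ x, ((deriv φ x : ℝ) : ℂ) * f x = - ∫ x, ((φ x : ℝ) : ℂ) * f' x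

/-- `f` belongs to `C_{p,l}` and `f'` is its weak derivative: `(1 + |x|^l) f ∈ L¹` and
`f' ∈ L^p`. -/
structure MemCpl (p : ℝ≥0∞) (l : ℝ) (f f' : ℝ → ℂ) : Prop where
  hasWeakDeriv : HasWeakDeriv f f'
  memLp_weight : MemLp (fun x : ℝ => ((1 + |x| ^ l : ℝ) : ℂ) * f x) 1 volume
  memLp_deriv : MemLp f' p volume

/-- The norm `‖(1 + |x|^l) f‖_1 + ‖f'‖_p` of a function `f` with weak derivative `f'`. -/
def normCpl (p : ℝ≥0∞) (l : ℝ) (f f' : ℝ → ℂ) : ℝ≥0∞ :=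
  eLpNorm (fun x : ℝ => ((1 + |x| ^ l : ℝ) : ℂ) * f x) 1 volume + eLpNorm f' p volume

/-- `c` and `1 / c` both belong to `L^∞(ℝ)`. The condition `c ≠ 0` almost everywhere is what makes
`1 / c` meaningful as a class of functions. -/
structure BddWithInverse (c : ℝ → ℝ) : Prop where
  memLp : MemLp c ∞ volume
  ne_zero : ∀ᵐ x : ℝ, c x ≠ 0
  memLp_inv : MemLp (fun x => 1 / c x) ∞ volume

/-- `γ(x, t) = ∑ c_j(x) |t|^{d_j}` with `m + 1 ≥ 1` terms, real exponents
`2 ≤ d_0 < d_1 < ⋯ < d_m`, `d_m > 2`, all `c_j` in `L^∞` and `1 / c_m` in `L^∞`. -/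
def IsPowerSumPhase (γ : ℝ → ℝ → ℝ) : Prop :=
  ∃ (m : ℕ) (c : Fin (m + 1) → ℝ → ℝ) (d : Fin (m + 1) → ℝ),
    (∀ x t, γ x t = ∑ j, c j x * |t| ^ d j) ∧
    (∀ j, MemLp (c j) ∞ volume) ∧ BddWithInverse (c (Fin.last m)) ∧
    2 ≤ d 0 ∧ StrictMono d ∧ 2 < d (Fin.last m)

/-- `γ(x, t) = a(x) t²` with `a` and `1 / a` in `L^∞`. -/
def IsQuadraticPhase (γ : ℝ → ℝ → ℝ) : Prop :=
  ∃ a : ℝ → ℝ, (∀ x t, γ x t = a x * t ^ 2) ∧ BddWithInverse a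

end

/-!
The maximal function is bounded pointwise, for almost every centre `x`, by an integrable function
whose integral is at most a constant times `N + Λ`, where `N = ‖(1 + |x|^l) f‖₁` and `Λ = ‖f'‖_p`.

By the du Bois-Reymond lemma (`HasWeakDeriv.exists_isPrimitive`) `f` may be replaced by a
continuous primitive `F` of `f'`. The exponent `p` enters only through the embedding
`L^p ⊆ L¹ + L^∞`: `|f'| ≤ g + Λ` with `∫ g ≤ Λ` (`MemLp.exists_dominatedBy`).

* Radii `r ≤ 1`: the average is at most the supremum of `|F|` over `[x - 1, x + 1]`. Comparing
  `F(y)` with its mean over `[y, y + δ]` for `δ = (1 + |x|)^{-l}` bounds this supremum by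
  `C ∫_{|z - x| ≤ 2} ((1 + |z|^l) |F(z)| + g(z)) dz + Λ (1 + |x|)^{-l}`
  (`IsPrimitive.enorm_le_local`), which is integrable in `x` because `l > 1`.
* Radii `1 ≤ r ≤ |x| / 2`: only points at distance at least `|x| / 2` from the origin are seen, so
  the average is at most `C |x|^{-l} N` (`average_le_of_le_half`).
* Radii `r ≥ |x| / 2`: the factor `1 / (2 r)` contributes `|x|^{-1}`. The part of `F` at distance
  more than `√|x|` from the origin has `L¹` norm at most `|x|^{-l/2} N`. On the rest `|t|` is
  comparable to `|x|`, the derivative of the phase is at least a multiple of `|x|`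
  (`exists_phase_bounds`), and one integration by parts
  (`IsPrimitive.enorm_integral_mul_exp_le`) gains `|x|^{-1}` against the loss
  `∫_{|y| ≤ √|x|} |f'| ≤ 3 √|x| Λ`. In total this is `O(|x|^{-3/2})` (`average_le_of_half_le`).

The quadratic phase is the power sum with the single exponent `2`, so both cases are treated
together.
-/

/-! ### Weak derivatives on the line -/

/-- `F` is a primitive of the locally integrable function `k` on the real line. -/
structure IsPrimitive (F k : ℝ → ℂ) : Prop where
  locallyIntegrable : LocallyIntegrable k volume
  sub_eq : ∀ a b, F b - F a = ∫ t in a..b, k t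

theorem MeasureTheory.LocallyIntegrable.intervalIntegrable' {k : ℝ → ℂ}
    (hk : LocallyIntegrable k volume) (a b : ℝ) : IntervalIntegrable k volume a b :=
  intervalIntegrable_iff.mpr <|
    (hk.integrableOn_isCompact isCompact_uIcc).mono_set Set.uIoc_subset_uIcc

theorem IsPrimitive.continuous {F k : ℝ → ℂ} (h : IsPrimitive F k) : Continuous F := by
  have h1 : F = fun x => F 0 + ∫ t in (0 : ℝ)..x, k t := by
    funext x
    rw [← h.sub_eq 0 x]
    ring
  rw [h1]
  exact continuous_const.add
    (intervalIntegral.continuous_primitive h.locallyIntegrable.intervalIntegrable' 0)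

theorem IsPrimitive.comp_sub {F k : ℝ → ℂ} (h : IsPrimitive F k) (x : ℝ) :
    IsPrimitive (fun t => F (x - t)) (fun t => -k (x - t)) where
  locallyIntegrable := by
    have h1 : LocallyIntegrable k (Measure.map (Homeomorph.subLeft x) volume) := by
      have h2 : Measure.map (Homeomorph.subLeft x) (volume : Measure ℝ) = volume :=
        (Measure.measurePreserving_sub_left volume x).map_eq
      rw [h2]
      exact h.locallyIntegrable
    exact ((locallyIntegrable_map_homeomorph (Homeomorph.subLeft x)).1 h1).neg
  sub_eq a b := by
    rw [h.sub_eq (x - a) (x - b), intervalIntegral.integral_neg,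
      intervalIntegral.integral_comp_sub_left, intervalIntegral.integral_symm]

/-- Fubini on the triangle `u < s ≤ t ≤ v`. -/
theorem integral_primitive_mul {k w : ℝ → ℂ} {u v : ℝ} (huv : u ≤ v)
    (hk : IntervalIntegrable k volume u v) (hw : IntervalIntegrable w volume u v) :
    ∫ t in u..v, (∫ s in u..t, k s) * w t = ∫ s in u..v, k s * ∫ t in s..v, w t := by
  have hk' : IntegrableOn k (Set.Ioc u v) := (intervalIntegrable_iff_integrableOn_Ioc_of_le huv).1 hk
  have hw' : IntegrableOn w (Set.Ioc u v) := (intervalIntegrable_iff_integrableOn_Ioc_of_le huv).1 hw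
  have hmeas : MeasurableSet {z : ℝ × ℝ | z.1 ≤ z.2} := measurableSet_le measurable_fst measurable_snd
  have hint : Integrable
      ({z : ℝ × ℝ | z.1 ≤ z.2}.indicator fun z : ℝ × ℝ => k z.1 * w z.2)
      ((volume.restrict (Set.Ioc u v)).prod (volume.restrict (Set.Ioc u v))) :=
    (Integrable.mul_prod hk' hw').indicator hmeas
  have hswap := integral_integral_swap
    (f := fun s t => {z : ℝ × ℝ | z.1 ≤ z.2}.indicator (fun z : ℝ × ℝ => k z.1 * w z.2) (s, t))
    (μ := volume.restrict (Set.Ioc u v)) (ν := volume.restrict (Set.Ioc u v)) hint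
  rw [intervalIntegral.integral_of_le huv, intervalIntegral.integral_of_le huv]
  refine Eq.trans ?_ (hswap.symm.trans ?_)
  · refine setIntegral_congr_fun measurableSet_Ioc fun t ht => ?_
    have h1 : ∀ s, {z : ℝ × ℝ | z.1 ≤ z.2}.indicator (fun z : ℝ × ℝ => k z.1 * w z.2) (s, t)
        = (Set.Iic t).indicator (fun s => k s * w t) s := by
      intro s
      simp [Set.indicator_apply]
    simp only [h1]
    rw [setIntegral_indicator measurableSet_Iic, Set.Ioc_inter_Iic, min_eq_right ht.2,
      integral_mul_const, intervalIntegral.integral_of_le ht.1.le]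
  · refine setIntegral_congr_fun measurableSet_Ioc fun s hs => ?_
    have h1 : ∀ t, {z : ℝ × ℝ | z.1 ≤ z.2}.indicator (fun z : ℝ × ℝ => k z.1 * w z.2) (s, t)
        = (Set.Ici s).indicator (fun t => k s * w t) t := by
      intro t
      simp [Set.indicator_apply]
    have h2 : Set.Ioc u v ∩ Set.Ici s = Set.Icc s v := by
      ext t
      simp only [Set.mem_inter_iff, Set.mem_Ioc, Set.mem_Ici, Set.mem_Icc]
      exact ⟨fun h => ⟨h.2, h.1.2⟩, fun h => ⟨⟨hs.1.trans_le h.1, h.2⟩, h.1⟩⟩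
    simp only [h1]
    rw [setIntegral_indicator measurableSet_Ici, h2, integral_const_mul,
      intervalIntegral.integral_of_le hs.2, integral_Icc_eq_integral_Ioc]

/-- Integration by parts of a primitive of a locally integrable function against a `C¹` function. -/
theorem IsPrimitive.integral_mul_deriv {F k w w' : ℝ → ℂ} (h : IsPrimitive F k) {u v : ℝ}
    (huv : u ≤ v) (hw : ∀ t ∈ Set.Icc u v, HasDerivAt w (w' t) t)
    (hw' : ContinuousOn w' (Set.Icc u v)) :
    ∫ t in u..v, F t * w' t = F v * w v - F u * w u - ∫ t in u..v, k t * w t := by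
  have hk := h.locallyIntegrable.intervalIntegrable' u v
  have hwi : IntervalIntegrable w' volume u v := by
    apply ContinuousOn.intervalIntegrable
    rwa [Set.uIcc_of_le huv]
  have hwc : ContinuousOn w (Set.uIcc u v) := by
    rw [Set.uIcc_of_le huv]
    exact fun t ht => (hw t ht).continuousAt.continuousWithinAt
  have hftc : ∀ s ∈ Set.Icc u v, ∫ t in s..v, w' t = w v - w s := by
    intro s hs
    have hsub : Set.uIcc s v ⊆ Set.Icc u v := by
      rw [Set.uIcc_of_le hs.2]
      exact Set.Icc_subset_Icc_left hs.1
    exact intervalIntegral.integral_eq_sub_of_hasDerivAt (fun t ht => hw t (hsub ht))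
      (hw'.mono hsub).intervalIntegrable
  have hprim : ContinuousOn (fun t => ∫ s in u..t, k s) (Set.uIcc u v) :=
    (intervalIntegral.continuous_primitive
      h.locallyIntegrable.intervalIntegrable' u).continuousOn
  have h1 : ∀ t, F t * w' t = F u * w' t + (∫ s in u..t, k s) * w' t := by
    intro t
    rw [← h.sub_eq u t]
    ring
  simp only [h1]
  rw [intervalIntegral.integral_add (hwi.const_mul _) (hwi.continuousOn_mul hprim),
    intervalIntegral.integral_const_mul, hftc u (Set.left_mem_Icc.2 huv),
    integral_primitive_mul huv hk hwi]
  have h2 : ∫ s in u..v, k s * ∫ t in s..v, w' t = ∫ s in u..v, (k s * w v - k s * w s) := by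
    apply intervalIntegral.integral_congr
    intro s hs
    rw [Set.uIcc_of_le huv] at hs
    simp only [hftc s hs]
    ring
  rw [h2, intervalIntegral.integral_sub (hk.mul_const _) (hk.mul_continuousOn hwc),
    intervalIntegral.integral_mul_const, ← h.sub_eq u v]
  ring

/-- A compactly supported function on the line is supported in some interval `(-R, R)`. -/
theorem HasCompactSupport.exists_tsupport_subset_Ioo {φ : ℝ → ℝ} (h : HasCompactSupport φ) :
    ∃ R > 0, tsupport φ ⊆ Set.Ioo (-R) R := by
  obtain ⟨R, hR⟩ := h.isCompact.isBounded.subset_ball_lt 0 0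
  refine ⟨R, hR.1, hR.2.trans ?_⟩
  rw [Real.ball_eq_Ioo]
  simp

/-- A primitive of `k` has weak derivative `k`. -/
theorem IsPrimitive.integral_deriv_mul {F k : ℝ → ℂ} (h : IsPrimitive F k) {φ : ℝ → ℝ}
    (hφ : ContDiff ℝ (⊤ : ℕ∞) φ) (hc : HasCompactSupport φ) :
    ∫ x, ((deriv φ x : ℝ) : ℂ) * F x = - ∫ x, ((φ x : ℝ) : ℂ) * k x := by
  obtain ⟨R, hR, hsub⟩ := hc.exists_tsupport_subset_Ioo
  have hφ0 : ∀ x, x ∉ Set.Ioo (-R) R → φ x = 0 := fun x hx =>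
    image_eq_zero_of_notMem_tsupport fun h' => hx (hsub h')
  have hs : ∀ x, φ x ≠ 0 → x ∈ Set.Ioc (-R) R := fun x hx =>
    Set.Ioo_subset_Ioc_self (by_contra fun h' => hx (hφ0 x h'))
  have hs' : ∀ x, deriv φ x ≠ 0 → x ∈ Set.Ioc (-R) R := fun x hx =>
    Set.Ioo_subset_Ioc_self (hsub (support_deriv_subset hx))
  have e1 : ∫ x, ((deriv φ x : ℝ) : ℂ) * F x = ∫ x in (-R)..R, F x * ((deriv φ x : ℝ) : ℂ) := by
    rw [← intervalIntegral.integral_eq_integral_of_support_subset (a := -R) (b := R)]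
    · simp only [mul_comm]
    · intro x hx
      exact hs' x fun h0 => hx (by simp [h0])
  have e2 : ∫ x, ((φ x : ℝ) : ℂ) * k x = ∫ x in (-R)..R, k x * ((φ x : ℝ) : ℂ) := by
    rw [← intervalIntegral.integral_eq_integral_of_support_subset (a := -R) (b := R)]
    · simp only [mul_comm]
    · intro x hx
      exact hs x fun h0 => hx (by simp [h0])
  have hd : Differentiable ℝ φ := hφ.differentiable (by simp)
  rw [e1, e2, h.integral_mul_deriv (w := fun x => ((φ x : ℝ) : ℂ)) (by linarith)
    (fun t _ => (hd t).hasDerivAt.ofReal_comp)]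
  · rw [hφ0 R (by simp), hφ0 (-R) (by simp)]
    simp
  · exact (Complex.continuous_ofReal.comp (hφ.continuous_deriv (by simp))).continuousOn

/-- A smooth compactly supported function of zero mean is the derivative of such a function. -/
theorem exists_deriv_eq_of_integral_eq_zero {η : ℝ → ℝ} (hη : ContDiff ℝ (⊤ : ℕ∞) η)
    (hc : HasCompactSupport η) (h0 : ∫ x, η x = 0) :
    ∃ φ : ℝ → ℝ, ContDiff ℝ (⊤ : ℕ∞) φ ∧ HasCompactSupport φ ∧ deriv φ = η := by
  obtain ⟨R, hR, hsub⟩ := hc.exists_tsupport_subset_Ioo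
  have hη0 : ∀ x, x ∉ Set.Ioo (-R) R → η x = 0 := fun x hx =>
    image_eq_zero_of_notMem_tsupport fun h' => hx (hsub h')
  have hd : ∀ x, HasDerivAt (fun x => ∫ t in (-R)..x, η t) (η x) x := fun x =>
    intervalIntegral.integral_hasDerivAt_right (hη.continuous.intervalIntegrable _ _)
      (hη.continuous.stronglyMeasurableAtFilter _ _) hη.continuous.continuousAt
  have hderiv : deriv (fun x => ∫ t in (-R)..x, η t) = η := funext fun x => (hd x).deriv
  refine ⟨fun x => ∫ t in (-R)..x, η t, ?_, ?_, hderiv⟩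
  · rw [contDiff_infty_iff_deriv, hderiv]
    exact ⟨fun x => (hd x).differentiableAt, hη⟩
  · refine HasCompactSupport.of_support_subset_isCompact (isCompact_Icc (a := -R) (b := R)) ?_
    intro x hx
    by_contra hx'
    apply hx
    simp only [Set.mem_Icc, not_and_or, not_le] at hx'
    rcases hx' with hx' | hx'
    · have : ∫ t in (-R)..x, η t = ∫ t in (-R)..x, (0 : ℝ) := by
        apply intervalIntegral.integral_congr
        intro t ht
        rw [Set.uIcc_of_ge hx'.le] at ht
        exact hη0 t fun h => absurd h.1 (not_lt.2 ht.2)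
      simp [this]
    · show ∫ t in (-R)..x, η t = 0
      rw [intervalIntegral.integral_eq_integral_of_support_subset, h0]
      intro t ht
      have := by_contra fun h' => ht (hη0 t h')
      exact ⟨this.1, this.2.le.trans hx'.le⟩

/-- A function with a weak derivative `f'` agrees almost everywhere with a primitive of `f'`
(the du Bois-Reymond lemma). -/
theorem HasWeakDeriv.exists_isPrimitive {f f' : ℝ → ℂ} (h : HasWeakDeriv f f') :
    ∃ F, IsPrimitive F f' ∧ f =ᵐ[volume] F := by
  set G : ℝ → ℂ := fun x => ∫ t in (0 : ℝ)..x, f' t with hG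
  have hii := h.locallyIntegrable_deriv.intervalIntegrable'
  have hGp : ∀ c : ℂ, IsPrimitive (fun x => G x + c) f' := fun c =>
    ⟨h.locallyIntegrable_deriv, fun a b => by
      rw [← intervalIntegral.integral_interval_sub_left (hii 0 b) (hii 0 a)]
      simp only [hG]
      ring⟩
  have hGp0 : IsPrimitive G f' := by simpa using hGp 0
  have hGl : LocallyIntegrable G volume := hGp0.continuous.locallyIntegrable
  have hint : ∀ {φ : ℝ → ℝ} {q : ℝ → ℂ}, Continuous φ → HasCompactSupport φ →
      LocallyIntegrable q volume → Integrable (fun x => φ x • q x) := fun hφ hc hq =>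
    hq.integrable_smul_left_of_hasCompactSupport hφ hc
  have hzero : ∀ φ : ℝ → ℝ, ContDiff ℝ (⊤ : ℕ∞) φ → HasCompactSupport φ →
      ∫ x, deriv φ x • (f x - G x) = 0 := by
    intro φ hφ hc
    have hcd := hφ.continuous_deriv (by simp)
    simp only [smul_sub]
    rw [integral_sub (hint hcd hc.deriv h.locallyIntegrable) (hint hcd hc.deriv hGl)]
    have h1 := h.integral_eq φ hφ hc
    have h2 := hGp0.integral_deriv_mul hφ hc
    simp only [Complex.real_smul]
    rw [h1, h2, sub_self]
  obtain ⟨b0, hb1, hb2, hb3⟩ : ∃ φ0 : ℝ → ℝ, ContDiff ℝ (⊤ : ℕ∞) φ0 ∧ HasCompactSupport φ0 ∧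
      ∫ x, φ0 x = 1 := by
    let b : ContDiffBump (0 : ℝ) := ⟨1, 2, one_pos, one_lt_two⟩
    exact ⟨b.normed volume, b.contDiff_normed, b.hasCompactSupport_normed, b.integral_normed⟩
  -- The constant value of `f - G`: testing against `ψ - (∫ ψ) b0`, a derivative, gives zero.
  set c : ℂ := ∫ x, b0 x • (f x - G x) with hc
  refine ⟨fun x => G x + c, hGp c, ?_⟩
  have hfG : LocallyIntegrable (fun x => f x - G x) := h.locallyIntegrable.sub hGl
  have key : ∀ᵐ x, f x - G x = c := by
    refine ae_eq_of_integral_contDiff_smul_eq hfG (locallyIntegrable_const c) fun ψ hψ hψc => ?_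
    have hψi : Integrable ψ := hψ.continuous.integrable_of_hasCompactSupport hψc
    have hbi : Integrable b0 := hb1.continuous.integrable_of_hasCompactSupport hb2
    obtain ⟨φ, hφ1, hφ2, hφ3⟩ := exists_deriv_eq_of_integral_eq_zero
      (η := fun x => ψ x - (∫ y, ψ y) * b0 x) (hψ.sub (contDiff_const.mul hb1))
      (hψc.sub hb2.mul_left) (by
        rw [integral_sub hψi (hbi.const_mul _), integral_const_mul, hb3]
        ring)
    have h1 := hzero φ hφ1 hφ2
    rw [hφ3] at h1
    have h2 : ∀ x, (ψ x - (∫ y, ψ y) * b0 x) • (f x - G x)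
        = ψ x • (f x - G x) - (∫ y, ψ y) • (b0 x • (f x - G x)) := by
      intro x
      rw [sub_smul, mul_smul]
    simp only [h2] at h1
    have h3 : Integrable (fun x => (∫ y, ψ y) • (b0 x • (f x - G x))) :=
      (hint hb1.continuous hb2 hfG).smul (∫ y, ψ y)
    rw [integral_sub (hint hψ.continuous hψc hfG) h3,
      integral_smul, sub_eq_zero] at h1
    refine h1.trans ?_
    rw [integral_smul_const]
  filter_upwards [key] with x hx
  rw [← hx]
  ring

/-! ### Functions dominated by an integrable function plus a constant -/

/-- `‖k‖` is dominated by `g + Λ` with `∫ g ≤ Λ`: the quantitative form of `k ∈ L¹ + L^∞`. -/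
structure DominatedBy (k : ℝ → ℂ) (g : ℝ → ℝ≥0∞) (Λ : ℝ≥0∞) : Prop where
  aemeasurable : AEMeasurable g volume
  lintegral_le : ∫⁻ x, g x ≤ Λ
  enorm_le : ∀ᵐ x, ‖k x‖ₑ ≤ g x + Λ

/-- The embedding `L^p ⊆ L¹ + L^∞`. For finite `p` the integrable part is
`Λ (‖k‖ / Λ)^p`, where `Λ = ‖k‖_p`. -/
theorem MeasureTheory.MemLp.exists_dominatedBy {k : ℝ → ℂ} {p : ℝ≥0∞} (hp : 1 ≤ p)
    (hk : MemLp k p volume) : ∃ g, DominatedBy k g (eLpNorm k p volume) := by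
  have hp0 : p ≠ 0 := (zero_lt_one.trans_le hp).ne'
  rcases eq_or_ne p ∞ with rfl | hpt
  · refine ⟨fun _ => 0, aemeasurable_const, by simp, ?_⟩
    simpa using ae_le_eLpNormEssSup (f := k) (μ := volume)
  rcases eq_or_ne (eLpNorm k p volume) 0 with h0 | h0
  · refine ⟨fun _ => 0, aemeasurable_const, by simp, ?_⟩
    filter_upwards [(eLpNorm_eq_zero_iff hk.1 hp0).1 h0] with x hx
    simp [hx]
  set Λ := eLpNorm k p volume with hΛ
  have hΛt : Λ ≠ ∞ := hk.2.ne
  have hpr : 1 ≤ p.toReal := by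
    rw [← ENNReal.toReal_one]
    exact ENNReal.toReal_mono hpt hp
  have hpr0 : 0 < p.toReal := by linarith
  have hpow : ∫⁻ x, ‖k x‖ₑ ^ p.toReal = Λ ^ p.toReal := by
    rw [hΛ, eLpNorm_eq_lintegral_rpow_enorm_toReal hp0 hpt, ← ENNReal.rpow_mul]
    field_simp
    simp
  have hmeas : AEMeasurable (fun x => ‖k x‖ₑ ^ p.toReal) volume :=
    hk.1.enorm.pow_const _
  refine ⟨fun x => Λ * (Λ⁻¹ ^ p.toReal * ‖k x‖ₑ ^ p.toReal),
    (hmeas.const_mul _).const_mul _, ?_, Filter.Eventually.of_forall fun x => ?_⟩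
  · rw [lintegral_const_mul'' _ (hmeas.const_mul _), lintegral_const_mul'' _ hmeas, hpow,
      ← ENNReal.mul_rpow_of_nonneg _ _ hpr0.le, ENNReal.inv_mul_cancel h0 hΛt]
    simp
  · rcases le_total (‖k x‖ₑ) Λ with h | h
    · exact h.trans le_add_self
    · refine le_trans ?_ le_self_add
      rw [← ENNReal.mul_rpow_of_nonneg _ _ hpr0.le]
      have h1 : 1 ≤ Λ⁻¹ * ‖k x‖ₑ := by
        rw [← ENNReal.inv_mul_cancel h0 hΛt]
        gcongr
      calc ‖k x‖ₑ = Λ * (Λ⁻¹ * ‖k x‖ₑ) := by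
            rw [← mul_assoc, ENNReal.mul_inv_cancel h0 hΛt, one_mul]
        _ ≤ Λ * (Λ⁻¹ * ‖k x‖ₑ) ^ p.toReal := by
            gcongr
            exact ENNReal.le_rpow_self_of_one_le h1 hpr

theorem DominatedBy.comp_sub {k : ℝ → ℂ} {g : ℝ → ℝ≥0∞} {Λ : ℝ≥0∞} (h : DominatedBy k g Λ)
    (x : ℝ) : DominatedBy (fun t => -k (x - t)) (fun t => g (x - t)) Λ where
  aemeasurable := h.aemeasurable.comp_quasiMeasurePreserving
    (Measure.measurePreserving_sub_left volume x).quasiMeasurePreserving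
  lintegral_le := by
    rw [lintegral_sub_left_eq_self (μ := volume) g x]
    exact h.lintegral_le
  enorm_le := by
    have := (Measure.measurePreserving_sub_left volume x).quasiMeasurePreserving.ae h.enorm_le
    filter_upwards [this] with t ht
    rwa [enorm_neg]

theorem DominatedBy.setLIntegral_le {k : ℝ → ℂ} {g : ℝ → ℝ≥0∞} {Λ : ℝ≥0∞}
    (h : DominatedBy k g Λ) (s : Set ℝ) :
    ∫⁻ x in s, ‖k x‖ₑ ≤ (∫⁻ x in s, g x) + Λ * volume s := by
  calc ∫⁻ x in s, ‖k x‖ₑ ≤ ∫⁻ x in s, (g x + Λ) := lintegral_mono_ae (ae_restrict_of_ae h.enorm_le)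
    _ = (∫⁻ x in s, g x) + Λ * volume s := by
      rw [lintegral_add_right _ measurable_const, setLIntegral_const]

theorem DominatedBy.setLIntegral_Icc_le {k : ℝ → ℂ} {g : ℝ → ℝ≥0∞} {Λ : ℝ≥0∞}
    (h : DominatedBy k g Λ) (a b : ℝ) :
    ∫⁻ x in Set.Icc a b, ‖k x‖ₑ ≤ Λ + Λ * ENNReal.ofReal (b - a) := by
  refine (h.setLIntegral_le _).trans ?_
  rw [Real.volume_Icc]
  gcongr
  exact (setLIntegral_le_lintegral _ _).trans h.lintegral_le

/-! ### Pointwise bounds for primitives -/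

/-- A primitive is bounded by its average over a short interval plus its variation there. -/
theorem IsPrimitive.enorm_le {F k : ℝ → ℂ} (h : IsPrimitive F k) (y : ℝ) {δ : ℝ} (hδ : 0 < δ) :
    ‖F y‖ₑ ≤ ENNReal.ofReal δ⁻¹ * (∫⁻ z in Set.Icc y (y + δ), ‖F z‖ₑ)
      + ∫⁻ z in Set.Icc y (y + δ), ‖k z‖ₑ := by
  set D := ∫⁻ z in Set.Icc y (y + δ), ‖k z‖ₑ with hD
  have hpt : ∀ z ∈ Set.Icc y (y + δ), ‖F y‖ₑ ≤ ‖F z‖ₑ + D := by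
    intro z hz
    have h1 : F y = F z - ∫ t in y..z, k t := by
      rw [← h.sub_eq y z]
      ring
    rw [h1]
    refine (enorm_sub_le).trans ?_
    gcongr
    rw [intervalIntegral.integral_of_le hz.1]
    refine (enorm_integral_le_lintegral_enorm _).trans (lintegral_mono_set ?_)
    exact Set.Ioc_subset_Icc_self.trans (Set.Icc_subset_Icc_right hz.2)
  have hv : volume (Set.Icc y (y + δ)) = ENNReal.ofReal δ := by
    rw [Real.volume_Icc]
    congr 1
    ring
  have h2 : ENNReal.ofReal δ * ‖F y‖ₑ ≤
      (∫⁻ z in Set.Icc y (y + δ), ‖F z‖ₑ) + ENNReal.ofReal δ * D := by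
    calc ENNReal.ofReal δ * ‖F y‖ₑ = ∫⁻ z in Set.Icc y (y + δ), ‖F y‖ₑ := by
          rw [setLIntegral_const, hv, mul_comm]
      _ ≤ ∫⁻ z in Set.Icc y (y + δ), (‖F z‖ₑ + D) := setLIntegral_mono' measurableSet_Icc hpt
      _ = _ := by
          rw [lintegral_add_right _ measurable_const, setLIntegral_const, hv, mul_comm D]
  have hinv : ENNReal.ofReal δ⁻¹ * ENNReal.ofReal δ = 1 := by
    rw [← ENNReal.ofReal_mul (by positivity), inv_mul_cancel₀ hδ.ne', ENNReal.ofReal_one]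
  calc ‖F y‖ₑ = ENNReal.ofReal δ⁻¹ * (ENNReal.ofReal δ * ‖F y‖ₑ) := by
        rw [← mul_assoc, hinv, one_mul]
    _ ≤ ENNReal.ofReal δ⁻¹ * ((∫⁻ z in Set.Icc y (y + δ), ‖F z‖ₑ) + ENNReal.ofReal δ * D) := by
        gcongr
    _ = _ := by rw [mul_add, ← mul_assoc _ _ D, hinv, one_mul]

theorem IsPrimitive.enorm_le_of_abs_sub_le {F k : ℝ → ℂ} {g : ℝ → ℝ≥0∞} {Λ : ℝ≥0∞}
    (h : IsPrimitive F k) (hk : DominatedBy k g Λ) {x y δ : ℝ} (hδ : 0 < δ) (hδ1 : δ ≤ 1)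
    (hxy : |y - x| ≤ 1) :
    ‖F y‖ₑ ≤ ENNReal.ofReal δ⁻¹ * (∫⁻ z in Set.Icc (x - 2) (x + 2), ‖F z‖ₑ)
      + (∫⁻ z in Set.Icc (x - 2) (x + 2), g z) + Λ * ENNReal.ofReal δ := by
  have hsub : Set.Icc y (y + δ) ⊆ Set.Icc (x - 2) (x + 2) := by
    rw [abs_le] at hxy
    exact Set.Icc_subset_Icc (by linarith) (by linarith)
  refine (h.enorm_le y hδ).trans ?_
  rw [add_assoc]
  gcongr
  refine (hk.setLIntegral_le _).trans ?_
  rw [Real.volume_Icc, add_sub_cancel_left]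
  gcongr

theorem IsPrimitive.enorm_le_add {F k : ℝ → ℂ} {g : ℝ → ℝ≥0∞} {Λ : ℝ≥0∞}
    (h : IsPrimitive F k) (hk : DominatedBy k g Λ) (y : ℝ) :
    ‖F y‖ₑ ≤ (∫⁻ z, ‖F z‖ₑ) + 2 * Λ := by
  refine (h.enorm_le y one_pos).trans ?_
  gcongr
  · rw [inv_one, ENNReal.ofReal_one, one_mul]
    exact setLIntegral_le_lintegral _ _
  · refine (hk.setLIntegral_Icc_le _ _).trans ?_
    rw [add_sub_cancel_left, ENNReal.ofReal_one, mul_one, two_mul]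

/-! ### Oscillatory integrals -/

theorem enorm_exp_I_mul (s : ℝ) : ‖Complex.exp (Complex.I * (s : ℂ))‖ₑ = 1 := by
  rw [mul_comm, ← ofReal_norm, Complex.norm_exp_ofReal_mul_I, ENNReal.ofReal_one]

/-- Nonstationary phase: one integration by parts against the primitive `-i e^{i φ} / φ'` of
`e^{i φ} (1 + i φ'' / φ'²)`. -/
theorem IsPrimitive.enorm_integral_mul_exp_le {F k : ℝ → ℂ} (h : IsPrimitive F k)
    {φ φ₁ φ₂ : ℝ → ℝ} {u v κ : ℝ} (huv : u ≤ v)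
    (hφ : ∀ t ∈ Set.Icc u v, HasDerivAt φ (φ₁ t) t)
    (hφ₁ : ∀ t ∈ Set.Icc u v, HasDerivAt φ₁ (φ₂ t) t) (hφ₂ : ContinuousOn φ₂ (Set.Icc u v))
    (h1 : ∀ t ∈ Set.Icc u v, 1 ≤ κ * |φ₁ t|) (h2 : ∀ t ∈ Set.Icc u v, |φ₂ t| ≤ κ * φ₁ t ^ 2)
    {S : ℝ≥0∞} (hS : ∀ t ∈ Set.Icc u v, ‖F t‖ₑ ≤ S) :
    ‖∫ t in u..v, F t * Complex.exp (Complex.I * (φ t : ℂ))‖ₑ ≤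
      ENNReal.ofReal κ * (2 * S + (∫⁻ t in Set.Icc u v, ‖k t‖ₑ) + ∫⁻ t in Set.Icc u v, ‖F t‖ₑ) := by
  set e : ℝ → ℂ := fun t => Complex.exp (Complex.I * (φ t : ℂ)) with he
  set w : ℝ → ℂ := fun t => -Complex.I * (e t / (φ₁ t : ℂ)) with hw
  set q : ℝ → ℂ := fun t => Complex.I * e t * ((φ₂ t / φ₁ t ^ 2 : ℝ) : ℂ) with hq
  have hne : ∀ t ∈ Set.Icc u v, φ₁ t ≠ 0 := by
    intro t ht h0
    have := h1 t ht
    rw [h0] at this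
    norm_num at this
  have hcφ : ContinuousOn φ (Set.Icc u v) := fun t ht => (hφ t ht).continuousAt.continuousWithinAt
  have hcφ₁ : ContinuousOn φ₁ (Set.Icc u v) :=
    fun t ht => (hφ₁ t ht).continuousAt.continuousWithinAt
  have hce : ContinuousOn e (Set.Icc u v) := by
    have : ContinuousOn (fun t => (φ t : ℂ)) (Set.Icc u v) :=
      Complex.continuous_ofReal.comp_continuousOn hcφ
    exact Complex.continuous_exp.comp_continuousOn (continuousOn_const.mul this)
  have hcq : ContinuousOn q (Set.Icc u v) := by
    have : ContinuousOn (fun t => φ₂ t / φ₁ t ^ 2) (Set.Icc u v) :=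
      hφ₂.div (hcφ₁.pow 2) fun t ht => pow_ne_zero 2 (hne t ht)
    exact (continuousOn_const.mul hce).mul (Complex.continuous_ofReal.comp_continuousOn this)
  have hdw : ∀ t ∈ Set.Icc u v, HasDerivAt w (e t + q t) t := by
    intro t ht
    have hn : (φ₁ t : ℂ) ≠ 0 := by exact_mod_cast hne t ht
    have d1 : HasDerivAt e (e t * (Complex.I * (φ₁ t : ℂ))) t :=
      ((hφ t ht).ofReal_comp.const_mul Complex.I).cexp
    have d2 := (d1.div (hφ₁ t ht).ofReal_comp hn).const_mul (-Complex.I)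
    refine d2.congr_deriv ?_
    simp only [hq]
    push_cast
    field_simp
    linear_combination (-(e t) * (φ₁ t : ℂ) ^ 2) * Complex.I_sq
  have hen : ∀ t, ‖e t‖ₑ = 1 := fun t => enorm_exp_I_mul _
  have hIn : ‖Complex.I‖ₑ = 1 := by
    rw [← ofReal_norm, Complex.norm_I, ENNReal.ofReal_one]
  have hwb : ∀ t ∈ Set.Icc u v, ‖w t‖ₑ ≤ ENNReal.ofReal κ := by
    intro t ht
    have hpos : 0 < |φ₁ t| := abs_pos.2 (hne t ht)
    rw [hw]
    simp only [div_eq_mul_inv, enorm_mul, enorm_neg, hen, hIn, one_mul]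
    rw [← Complex.ofReal_inv, ← ofReal_norm, Complex.norm_real, Real.norm_eq_abs, abs_inv]
    apply ENNReal.ofReal_le_ofReal
    rw [inv_le_iff_one_le_mul₀ hpos]
    exact h1 t ht
  have hqb : ∀ t ∈ Set.Icc u v, ‖q t‖ₑ ≤ ENNReal.ofReal κ := by
    intro t ht
    have hpos : 0 < φ₁ t ^ 2 := by
      have := hne t ht
      positivity
    rw [hq]
    simp only [enorm_mul, hen, hIn, one_mul]
    rw [← ofReal_norm, Complex.norm_real, Real.norm_eq_abs, abs_div, abs_of_pos hpos]
    apply ENNReal.ofReal_le_ofReal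
    rw [div_le_iff₀ hpos]
    exact h2 t ht
  have hFc := h.continuous
  have hii : ∀ {a : ℝ → ℂ}, ContinuousOn a (Set.Icc u v) →
      IntervalIntegrable (fun t => F t * a t) volume u v := by
    intro a ha
    apply ContinuousOn.intervalIntegrable
    rw [Set.uIcc_of_le huv]
    exact hFc.continuousOn.mul ha
  have hadd : IntervalIntegrable (fun t => F t * (e t + q t)) volume u v := hii (hce.add hcq)
  have hsplit : ∫ t in u..v, F t * e t = F v * w v - F u * w u - (∫ t in u..v, k t * w t)
      - ∫ t in u..v, F t * q t := by
    rw [← h.integral_mul_deriv huv hdw (hce.add hcq),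
      ← intervalIntegral.integral_sub hadd (hii hcq)]
    congr 1
    funext t
    ring
  have hbd : ∀ (a b : ℝ → ℂ), (∀ t ∈ Set.Icc u v, ‖b t‖ₑ ≤ ENNReal.ofReal κ) →
      ‖∫ t in u..v, a t * b t‖ₑ ≤ ENNReal.ofReal κ * ∫⁻ t in Set.Icc u v, ‖a t‖ₑ := by
    intro a b hb
    rw [intervalIntegral.integral_of_le huv, ← integral_Icc_eq_integral_Ioc]
    refine (enorm_integral_le_lintegral_enorm _).trans ?_
    rw [← lintegral_const_mul' _ _ ENNReal.ofReal_ne_top]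
    refine setLIntegral_mono' measurableSet_Icc fun t ht => ?_
    rw [enorm_mul, mul_comm]
    gcongr
    exact hb t ht
  have hend : ∀ t ∈ Set.Icc u v, ‖F t * w t‖ₑ ≤ ENNReal.ofReal κ * S := by
    intro t ht
    rw [enorm_mul, mul_comm]
    gcongr
    · exact hwb t ht
    · exact hS t ht
  rw [hsplit]
  calc _ ≤ ‖F v * w v‖ₑ + ‖F u * w u‖ₑ + ‖∫ t in u..v, k t * w t‖ₑ + ‖∫ t in u..v, F t * q t‖ₑ := by
        refine enorm_sub_le.trans ?_
        gcongr
        refine enorm_sub_le.trans ?_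
        gcongr
        exact enorm_sub_le
    _ ≤ ENNReal.ofReal κ * S + ENNReal.ofReal κ * S
        + ENNReal.ofReal κ * (∫⁻ t in Set.Icc u v, ‖k t‖ₑ)
        + ENNReal.ofReal κ * ∫⁻ t in Set.Icc u v, ‖F t‖ₑ := by
        gcongr
        · exact hend v (Set.right_mem_Icc.2 huv)
        · exact hend u (Set.left_mem_Icc.2 huv)
        · exact hbd k w hwb
        · exact hbd F q hqb
    _ = _ := by ring

/-! ### Power sum phases -/

theorem hasDerivAt_sum_mul_rpow {n : ℕ} (c d : Fin n → ℝ) {t : ℝ} (ht : 0 < t) :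
    HasDerivAt (fun t : ℝ => ∑ j, c j * t ^ d j) (∑ j, c j * d j * t ^ (d j - 1)) t := by
  apply HasDerivAt.fun_sum
  intro j _
  simpa [mul_assoc] using (Real.hasDerivAt_rpow_const (p := d j) (Or.inl ht.ne')).const_mul (c j)

theorem hasDerivAt_sum_mul_abs_rpow {n : ℕ} (c d : Fin n → ℝ) {t : ℝ} (ht : 0 < t) :
    HasDerivAt (fun t : ℝ => ∑ j, c j * |t| ^ d j) (∑ j, c j * d j * t ^ (d j - 1)) t := by
  refine (hasDerivAt_sum_mul_rpow c d ht).congr_of_eventuallyEq ?_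
  filter_upwards [lt_mem_nhds ht] with s hs
  rw [abs_of_pos hs]

/-- For large `t` the phase `∑ c_j t^{d_j}` has derivative of order at least `t`, and its second
derivative is small compared with the square of the first, uniformly over the coefficients. -/
theorem exists_phase_bounds {m : ℕ} (d : Fin (m + 1) → ℝ) (hd0 : 2 ≤ d 0) (hd : StrictMono d)
    {A : ℝ} (hA : 0 < A) :
    ∃ R ≥ (1 : ℝ), ∃ K > (0 : ℝ), ∀ c : Fin (m + 1) → ℝ, (∀ j, |c j| ≤ A) →
      A⁻¹ ≤ |c (Fin.last m)| → ∀ t ≥ R,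
        t ≤ K * |∑ j, c j * d j * t ^ (d j - 1)| ∧
        t * |∑ j, c j * d j * (d j - 1) * t ^ (d j - 1 - 1)|
          ≤ K * (∑ j, c j * d j * t ^ (d j - 1)) ^ 2 := by
  set D := d (Fin.last m) with hD
  have hd2 : ∀ j, 2 ≤ d j := fun j => hd0.trans (hd.monotone (Fin.zero_le j))
  have hdD : ∀ j, d j ≤ D := fun j => hd.monotone (Fin.le_last j)
  have hD2 : 2 ≤ D := hd2 _
  have hlim : Filter.Tendsto (fun t : ℝ => ∑ i : Fin m, A * d i.castSucc * t ^ (-(D - d i.castSucc)))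
      Filter.atTop (nhds 0) := by
    rw [← Finset.sum_const_zero (s := (Finset.univ : Finset (Fin m)))]
    refine tendsto_finsetSum _ fun i _ => ?_
    rw [← mul_zero (A * d i.castSucc)]
    exact (tendsto_rpow_neg_atTop (sub_pos.2 (hd (Fin.castSucc_lt_last i)))).const_mul _
  obtain ⟨R, hR⟩ := Filter.eventually_atTop.1 (hlim.eventually_le_const (inv_pos.2 hA))
  -- `B t ^ (D - 2)` bounds the second derivative.
  set B := ∑ j, A * d j * (d j - 1) with hB
  have hB0 : 0 ≤ B := Finset.sum_nonneg fun j _ => by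
    have := hd2 j
    exact mul_nonneg (by positivity) (by linarith)
  refine ⟨max R 1, le_max_right _ _, A + B * A ^ 2, by positivity, fun c hc hcl t ht => ?_⟩
  have ht1 : 1 ≤ t := (le_max_right _ _).trans ht
  have ht0 : 0 < t := by linarith
  have hlow : ∑ i : Fin m, A * d i.castSucc * t ^ (d i.castSucc - 1) ≤ A⁻¹ * t ^ (D - 1) := by
    have h1 := hR t ((le_max_left _ _).trans ht)
    calc ∑ i : Fin m, A * d i.castSucc * t ^ (d i.castSucc - 1)
        = (∑ i : Fin m, A * d i.castSucc * t ^ (-(D - d i.castSucc))) * t ^ (D - 1) := by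
          rw [Finset.sum_mul]
          refine Finset.sum_congr rfl fun i _ => ?_
          rw [mul_assoc _ _ (t ^ (D - 1)), ← Real.rpow_add ht0]
          congr 2
          ring
      _ ≤ _ := by gcongr
  have hfirst : A⁻¹ * t ^ (D - 1) ≤ |∑ j, c j * d j * t ^ (d j - 1)| := by
    rw [Fin.sum_univ_castSucc]
    have h1 : |∑ i : Fin m, c i.castSucc * d i.castSucc * t ^ (d i.castSucc - 1)|
        ≤ A⁻¹ * t ^ (D - 1) := by
      refine (Finset.abs_sum_le_sum_abs _ _).trans (le_trans (Finset.sum_le_sum fun i _ => ?_) hlow)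
      have := hd2 i.castSucc
      rw [abs_mul, abs_mul, abs_of_nonneg (by linarith : 0 ≤ d i.castSucc),
        abs_of_pos (Real.rpow_pos_of_pos ht0 _)]
      gcongr
      exact hc _
    have h2 : 2 * (A⁻¹ * t ^ (D - 1)) ≤ |c (Fin.last m) * D * t ^ (D - 1)| := by
      rw [abs_mul, abs_mul, abs_of_nonneg (by linarith : 0 ≤ D),
        abs_of_pos (Real.rpow_pos_of_pos ht0 _)]
      calc 2 * (A⁻¹ * t ^ (D - 1)) = A⁻¹ * 2 * t ^ (D - 1) := by ring
        _ ≤ |c (Fin.last m)| * D * t ^ (D - 1) := by gcongr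
    have h3 := abs_sub_abs_le_abs_sub (c (Fin.last m) * D * t ^ (D - 1))
      (-∑ i : Fin m, c i.castSucc * d i.castSucc * t ^ (d i.castSucc - 1))
    rw [abs_neg, sub_neg_eq_add, add_comm (c (Fin.last m) * D * t ^ (D - 1))] at h3
    linarith
  have hsecond : t * |∑ j, c j * d j * (d j - 1) * t ^ (d j - 1 - 1)| ≤ B * t ^ (D - 1) := by
    have h1 : |∑ j, c j * d j * (d j - 1) * t ^ (d j - 1 - 1)| ≤ B * t ^ (D - 1 - 1) := by
      rw [hB, Finset.sum_mul]
      refine (Finset.abs_sum_le_sum_abs _ _).trans (Finset.sum_le_sum fun j _ => ?_)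
      have := hd2 j
      rw [abs_mul, abs_mul, abs_mul, abs_of_nonneg (by linarith : 0 ≤ d j),
        abs_of_nonneg (by linarith : 0 ≤ d j - 1), abs_of_pos (Real.rpow_pos_of_pos ht0 _)]
      have h2 : 0 ≤ d j - 1 := by linarith
      gcongr
      · exact hc j
      · exact hdD j
    calc _ ≤ t * (B * t ^ (D - 1 - 1)) := by gcongr
      _ = B * t ^ (D - 1) := by
        rw [Real.rpow_sub_one ht0.ne' (D - 1)]
        field_simp
  set P := ∑ j, c j * d j * t ^ (d j - 1) with hP
  have hAP : t ^ (D - 1) ≤ A * |P| := by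
    rwa [inv_mul_le_iff₀ hA] at hfirst
  have htD : t ≤ t ^ (D - 1) := by
    conv_lhs => rw [← Real.rpow_one t]
    exact Real.rpow_le_rpow_of_exponent_le ht1 (by linarith)
  have h1P : 1 ≤ A * |P| := ht1.trans (htD.trans hAP)
  have hBA : 0 ≤ B * A ^ 2 := by positivity
  constructor
  · nlinarith [abs_nonneg P]
  · have h4 : B * t ^ (D - 1) ≤ B * (A * |P|) * (A * |P|) := by
      calc B * t ^ (D - 1) ≤ B * (A * |P|) * 1 := by rw [mul_one]; gcongr
        _ ≤ _ := by gcongr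
    have h5 : B * (A * |P|) * (A * |P|) = B * A ^ 2 * P ^ 2 := by
      rw [← sq_abs P]
      ring
    nlinarith [sq_nonneg P]

/-! ### Averages over long intervals -/

/-- The part of `f` far away from the origin is small in `L¹`. -/
theorem setLIntegral_comp_sub_le {F : ℝ → ℂ} {N : ℝ≥0∞} {l : ℝ} (hl : 0 ≤ l)
    (hN : ∫⁻ y, ENNReal.ofReal (1 + |y| ^ l) * ‖F y‖ₑ ≤ N) {x ρ : ℝ} (hρ : 0 < ρ) {T : Set ℝ}
    (hT : MeasurableSet T) (h : ∀ t ∈ T, ρ ≤ |x - t|) :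
    ∫⁻ t in T, ‖F (x - t)‖ₑ ≤ ENNReal.ofReal (ρ ^ (-l)) * N := by
  calc ∫⁻ t in T, ‖F (x - t)‖ₑ
      ≤ ∫⁻ t in T, ENNReal.ofReal (ρ ^ (-l)) *
          (ENNReal.ofReal (1 + |x - t| ^ l) * ‖F (x - t)‖ₑ) := by
        refine setLIntegral_mono' hT fun t ht => ?_
        rw [← mul_assoc, ← ENNReal.ofReal_mul (by positivity)]
        refine le_mul_of_one_le_left (zero_le) ?_
        rw [ENNReal.one_le_ofReal]
        have h1 : ρ ^ l ≤ |x - t| ^ l := Real.rpow_le_rpow hρ.le (h t ht) hl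
        have h2 : ρ ^ (-l) * ρ ^ l = 1 := by
          rw [← Real.rpow_add hρ]
          simp
        have h3 : 0 < ρ ^ (-l) := by positivity
        nlinarith
    _ ≤ ∫⁻ t, ENNReal.ofReal (ρ ^ (-l)) *
          (ENNReal.ofReal (1 + |x - t| ^ l) * ‖F (x - t)‖ₑ) := setLIntegral_le_lintegral _ _
    _ = ENNReal.ofReal (ρ ^ (-l)) * ∫⁻ y, ENNReal.ofReal (1 + |y| ^ l) * ‖F y‖ₑ := by
        rw [lintegral_const_mul' _ _ ENNReal.ofReal_ne_top,
          lintegral_sub_left_eq_self (μ := volume)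
            (fun y => ENNReal.ofReal (1 + |y| ^ l) * ‖F y‖ₑ) x]
    _ ≤ _ := by gcongr

theorem lintegral_enorm_le_of_weight {F : ℝ → ℂ} {N : ℝ≥0∞} {l : ℝ}
    (hN : ∫⁻ y, ENNReal.ofReal (1 + |y| ^ l) * ‖F y‖ₑ ≤ N) : ∫⁻ y, ‖F y‖ₑ ≤ N := by
  refine le_trans (lintegral_mono fun y => ?_) hN
  refine le_mul_of_one_le_left (zero_le) ?_
  rw [ENNReal.one_le_ofReal]
  have : 0 ≤ |y| ^ l := by positivity
  linarith

theorem enorm_intervalIntegral_mul_exp_le (F : ℝ → ℂ) (φ : ℝ → ℝ) (x : ℝ) {r : ℝ} (hr : 0 ≤ r) :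
    ‖∫ t in (-r)..r, F (x - t) * Complex.exp (Complex.I * (φ t : ℂ))‖ₑ
      ≤ ∫⁻ t in Set.Ioc (-r) r, ‖F (x - t)‖ₑ := by
  rw [intervalIntegral.integral_of_le (by linarith)]
  refine (enorm_integral_le_lintegral_enorm _).trans (le_of_eq ?_)
  simp only [enorm_mul, enorm_exp_I_mul, mul_one]

/-- Radii up to `x / 2`: the average only sees points at distance at least `x / 2` from the
origin. -/
theorem average_le_of_le_half {F : ℝ → ℂ} {N : ℝ≥0∞} {l : ℝ} (hl : 0 ≤ l)
    (hN : ∫⁻ y, ENNReal.ofReal (1 + |y| ^ l) * ‖F y‖ₑ ≤ N) (φ : ℝ → ℝ) {x r : ℝ} (hr : 1 ≤ r)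
    (hrx : r ≤ x / 2) :
    ENNReal.ofReal (1 / (2 * r)) *
      ‖∫ t in (-r)..r, F (x - t) * Complex.exp (Complex.I * (φ t : ℂ))‖ₑ
      ≤ ENNReal.ofReal ((x / 2) ^ (-l)) * N := by
  have h1 : ENNReal.ofReal (1 / (2 * r)) ≤ 1 := by
    rw [ENNReal.ofReal_le_one, div_le_one (by linarith)]
    linarith
  calc _ ≤ 1 * ∫⁻ t in Set.Ioc (-r) r, ‖F (x - t)‖ₑ := by
        gcongr
        exact enorm_intervalIntegral_mul_exp_le F φ x (by linarith)
    _ ≤ _ := by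
        rw [one_mul]
        refine setLIntegral_comp_sub_le hl hN (by linarith) measurableSet_Ioc fun t ht => ?_
        rw [abs_of_nonneg (by linarith [ht.2])]
        linarith [ht.2]

/-- Radii beyond `x / 2`: within `√x` of the origin the phase oscillates, and the rest of `F` is
small in `L¹`. -/
theorem average_le_of_half_le {F k : ℝ → ℂ} {g : ℝ → ℝ≥0∞} {N Λ : ℝ≥0∞} {l : ℝ} (hl : 1 ≤ l)
    (hF : IsPrimitive F k) (hk : DominatedBy k g Λ)
    (hN : ∫⁻ y, ENNReal.ofReal (1 + |y| ^ l) * ‖F y‖ₑ ≤ N) {φ φ₁ φ₂ : ℝ → ℝ} {x r K : ℝ}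
    (hx : 4 ≤ x) (hrx : x / 2 ≤ r) (hK : 0 ≤ K)
    (hφ : ∀ t, x / 2 ≤ t → HasDerivAt φ (φ₁ t) t) (hφ₁ : ∀ t, x / 2 ≤ t → HasDerivAt φ₁ (φ₂ t) t)
    (hφ₂ : ContinuousOn φ₂ (Set.Ici (x / 2)))
    (h1 : ∀ t, x / 2 ≤ t → t ≤ K * |φ₁ t|)
    (h2 : ∀ t, x / 2 ≤ t → t * |φ₂ t| ≤ K * φ₁ t ^ 2) :
    ENNReal.ofReal (1 / (2 * r)) *
      ‖∫ t in (-r)..r, F (x - t) * Complex.exp (Complex.I * (φ t : ℂ))‖ₑ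
      ≤ ENNReal.ofReal ((1 + 14 * K) * x ^ (-(3 / 2) : ℝ)) * (N + Λ) := by
  have hx0 : 0 < x := by linarith
  set s := √x with hs
  have hss : s * s = x := Real.mul_self_sqrt hx0.le
  have hs0 : 0 < s := Real.sqrt_pos.2 hx0
  have hs2 : 2 ≤ s := by
    rw [hs, Real.le_sqrt (by norm_num) hx0.le]
    linarith
  have hsx : s ≤ x / 2 := by nlinarith
  set E : ℝ → ℂ := fun t => F (x - t) * Complex.exp (Complex.I * (φ t : ℂ)) with hE
  have hEn : ∀ t, ‖E t‖ₑ = ‖F (x - t)‖ₑ := fun t => by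
    simp only [hE, enorm_mul, enorm_exp_I_mul, mul_one]
  set T := Set.Ioc (-r) r with hT
  set J := Set.Ioc (x - s) (x + s) with hJ
  have hFl : ∫⁻ y, ‖F y‖ₑ ≤ N := lintegral_enorm_le_of_weight hN
  have hfar : ∫⁻ t in T \ J, ‖F (x - t)‖ₑ ≤ ENNReal.ofReal s⁻¹ * N := by
    refine (setLIntegral_comp_sub_le (by linarith) hN hs0
      (measurableSet_Ioc.diff measurableSet_Ioc) fun t ht => ?_).trans ?_
    · rcases le_or_gt t (x - s) with h | h
      · rw [abs_of_nonneg (by linarith)]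
        linarith
      · have h3 : x + s < t := by
          by_contra h4
          exact ht.2 ⟨h, not_lt.1 h4⟩
        rw [abs_of_nonpos (by linarith)]
        linarith
    · gcongr
      rw [← Real.rpow_neg_one]
      exact Real.rpow_le_rpow_of_exponent_le (by linarith) (by linarith)
  have hnear : ‖∫ t in T ∩ J, E t‖ₑ ≤ ENNReal.ofReal (2 * K / x) *
      (ENNReal.ofReal (7 * s) * (N + Λ)) := by
    have hTJ : T ∩ J = Set.Ioc (x - s) (min r (x + s)) := by
      rw [hT, hJ, Set.Ioc_inter_Ioc]
      congr 1
      exact max_eq_right (by linarith)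
    rw [hTJ]
    rcases le_total (min r (x + s)) (x - s) with hle | hle
    · rw [Set.Ioc_eq_empty (not_lt.2 hle)]
      simp
    rw [← intervalIntegral.integral_of_le hle]
    have hge : ∀ t ∈ Set.Icc (x - s) (min r (x + s)), x / 2 ≤ t := fun t ht => by
      linarith [ht.1]
    -- On this interval `t ≥ x / 2`, so the phase derivative is at least `x / (2 * K)`.
    have hosc := (hF.comp_sub x).enorm_integral_mul_exp_le (φ := φ) (φ₁ := φ₁) (φ₂ := φ₂)
      (κ := 2 * K / x) (S := N + 2 * Λ) hle
      (fun t ht => hφ t (hge t ht)) (fun t ht => hφ₁ t (hge t ht))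
      (hφ₂.mono hge)
      (fun t ht => by
        have h3 := h1 t (hge t ht)
        have h4 := hge t ht
        rw [div_mul_eq_mul_div, le_div_iff₀ hx0]
        linarith)
      (fun t ht => by
        have h3 := h2 t (hge t ht)
        have h4 := hge t ht
        rw [div_mul_eq_mul_div, le_div_iff₀ hx0]
        nlinarith [abs_nonneg (φ₂ t)])
      (fun t _ => by
        refine (hF.enorm_le_add hk (x - t)).trans ?_
        gcongr)
    refine hosc.trans ?_
    gcongr
    have hs1 : 1 ≤ ENNReal.ofReal s := by
      rw [ENNReal.one_le_ofReal]
      linarith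
    have e1 : ∫⁻ t in Set.Icc (x - s) (min r (x + s)), ‖-k (x - t)‖ₑ
        ≤ Λ + Λ * ENNReal.ofReal (2 * s) := by
      refine ((hk.comp_sub x).setLIntegral_Icc_le _ _).trans ?_
      gcongr
      linarith [min_le_right r (x + s)]
    have e2 : ∫⁻ t in Set.Icc (x - s) (min r (x + s)), ‖F (x - t)‖ₑ ≤ N := by
      refine (setLIntegral_le_lintegral _ _).trans ?_
      rwa [lintegral_sub_left_eq_self (μ := volume) (fun y => ‖F y‖ₑ) x]
    calc _ ≤ 2 * (N + 2 * Λ) + (Λ + Λ * ENNReal.ofReal (2 * s)) + N := by gcongr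
      _ = 3 * N * 1 + (5 * Λ * 1 + 2 * Λ * ENNReal.ofReal s) := by
          rw [ENNReal.ofReal_mul (by norm_num), ENNReal.ofReal_ofNat]
          ring
      _ ≤ 3 * N * ENNReal.ofReal s + 4 * N * ENNReal.ofReal s
          + (5 * Λ * ENNReal.ofReal s + 2 * Λ * ENNReal.ofReal s) := by
          gcongr
          exact le_add_right (by gcongr)
      _ = ENNReal.ofReal (7 * s) * (N + Λ) := by
          rw [ENNReal.ofReal_mul (by norm_num), ENNReal.ofReal_ofNat]
          ring
  -- The interval `(-r, r]` is split along the points `t` within `√x` of `x`.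
  have hwhole : ‖∫ t in (-r)..r, E t‖ₑ ≤
      ENNReal.ofReal s⁻¹ * N + ENNReal.ofReal (2 * K / x) * (ENNReal.ofReal (7 * s) * (N + Λ)) := by
    rw [intervalIntegral.integral_of_le (by linarith)]
    by_cases hint : IntegrableOn E T
    · rw [← integral_inter_add_sdiff (measurableSet_Ioc : MeasurableSet J) hint, add_comm]
      refine (enorm_add_le _ _).trans ?_
      gcongr
      refine (enorm_integral_le_lintegral_enorm _).trans ?_
      simp only [hEn]
      exact hfar
    · rw [integral_undef hint]
      simp
  have hpow : x ^ (-(3 / 2) : ℝ) = x⁻¹ * s⁻¹ := by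
    rw [hs, Real.sqrt_eq_rpow, ← Real.rpow_neg_one x, ← Real.rpow_neg_one (x ^ _),
      ← Real.rpow_mul hx0.le, ← Real.rpow_add hx0]
    norm_num
  have hrr : ENNReal.ofReal (1 / (2 * r)) ≤ ENNReal.ofReal x⁻¹ := by
    apply ENNReal.ofReal_le_ofReal
    rw [one_div]
    exact inv_anti₀ hx0 (by linarith)
  calc _ ≤ ENNReal.ofReal x⁻¹ * (ENNReal.ofReal s⁻¹ * (N + Λ)
        + ENNReal.ofReal (2 * K / x) * (ENNReal.ofReal (7 * s) * (N + Λ))) := by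
        gcongr
        refine hwhole.trans ?_
        gcongr
        exact le_self_add
    _ = ENNReal.ofReal (x⁻¹ * (s⁻¹ + 2 * K / x * (7 * s))) * (N + Λ) := by
        rw [ENNReal.ofReal_mul (p := x⁻¹) (by positivity),
          ENNReal.ofReal_add (by positivity) (by positivity),
          ENNReal.ofReal_mul (p := 2 * K / x) (by positivity)]
        ring
    _ = _ := by
        congr 2
        rw [hpow]
        have : 2 * K / x * (7 * s) = 14 * K * s⁻¹ := by
          rw [← hss]
          field_simp
          ring
        rw [this]
        ring

theorem lintegral_weight_comp_neg (F : ℝ → ℂ) (l : ℝ) :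
    ∫⁻ y, ENNReal.ofReal (1 + |y| ^ l) * ‖F (0 - y)‖ₑ
      = ∫⁻ y, ENNReal.ofReal (1 + |y| ^ l) * ‖F y‖ₑ := by
  rw [← lintegral_sub_left_eq_self (μ := volume)
    (fun y => ENNReal.ofReal (1 + |y| ^ l) * ‖F y‖ₑ) 0]
  simp only [zero_sub, abs_neg]

/-- Averages over intervals of radius at least `1` are bounded by an integrable function of the
centre. -/
theorem exists_average_bound {m : ℕ} (d : Fin (m + 1) → ℝ) (hd0 : 2 ≤ d 0) (hd : StrictMono d)
    {A : ℝ} (hA : 0 < A) {l : ℝ} (hl : 1 < l) (hl2 : l < 2) :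
    ∃ K : ℝ, 0 ≤ K ∧ ∀ c : Fin (m + 1) → ℝ, (∀ j, |c j| ≤ A) → A⁻¹ ≤ |c (Fin.last m)| →
      ∀ (F k : ℝ → ℂ) (g : ℝ → ℝ≥0∞) (N Λ : ℝ≥0∞), IsPrimitive F k → DominatedBy k g Λ →
        ∫⁻ y, ENNReal.ofReal (1 + |y| ^ l) * ‖F y‖ₑ ≤ N → ∀ x r : ℝ, 1 ≤ r →
        ENNReal.ofReal (1 / (2 * r)) * ‖∫ t in (-r)..r, F (x - t) *
            Complex.exp (Complex.I * ((∑ j, c j * |t| ^ d j : ℝ) : ℂ))‖ₑ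
          ≤ ENNReal.ofReal (K * ((1 + |x|) ^ (-l) + (1 + |x|) ^ (-(3 / 2) : ℝ))) * (N + Λ) := by
  obtain ⟨R, hR1, K, hK, hphase⟩ := exists_phase_bounds d hd0 hd hA
  set R₀ := max 4 (2 * R) with hR₀
  have hR₀0 : 0 < R₀ := lt_of_lt_of_le (by norm_num) (le_max_left _ _)
  set M := 16 * (1 + 14 * K) + (1 + R₀) ^ l with hM
  have hRl : 0 < (1 + R₀) ^ l := by positivity
  have hM0 : 0 ≤ M := by positivity
  have key : ∀ c : Fin (m + 1) → ℝ, (∀ j, |c j| ≤ A) → A⁻¹ ≤ |c (Fin.last m)| →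
      ∀ (F k : ℝ → ℂ) (g : ℝ → ℝ≥0∞) (N Λ : ℝ≥0∞), IsPrimitive F k → DominatedBy k g Λ →
        ∫⁻ y, ENNReal.ofReal (1 + |y| ^ l) * ‖F y‖ₑ ≤ N → ∀ x r : ℝ, 0 ≤ x → 1 ≤ r →
        ENNReal.ofReal (1 / (2 * r)) * ‖∫ t in (-r)..r, F (x - t) *
            Complex.exp (Complex.I * ((∑ j, c j * |t| ^ d j : ℝ) : ℂ))‖ₑ
          ≤ ENNReal.ofReal (M * ((1 + x) ^ (-l) + (1 + x) ^ (-(3 / 2) : ℝ))) * (N + Λ) := by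
    intro c hc hcl F k g N Λ hF hk hN x r hx hr
    have hp1 : 0 < (1 + x) ^ (-l) := by positivity
    have hp2 : 0 < (1 + x) ^ (-(3 / 2) : ℝ) := by positivity
    rcases le_or_gt x R₀ with hxR | hxR
    · -- On the bounded range of centres the average is at most `‖F‖₁`.
      have h1 : ENNReal.ofReal (1 / (2 * r)) ≤ 1 := by
        rw [ENNReal.ofReal_le_one, div_le_one (by linarith)]
        linarith
      have h2 : 1 ≤ M * ((1 + x) ^ (-l) + (1 + x) ^ (-(3 / 2) : ℝ)) := by
        have h3 : 1 ≤ (1 + R₀) ^ l * (1 + x) ^ (-l) := by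
          rw [Real.rpow_neg (by positivity), ← div_eq_mul_inv, one_le_div (by positivity)]
          gcongr
        calc (1 : ℝ) ≤ (1 + R₀) ^ l * (1 + x) ^ (-l) := h3
          _ ≤ M * ((1 + x) ^ (-l) + (1 + x) ^ (-(3 / 2) : ℝ)) := by
            gcongr
            · rw [hM]
              linarith
            · linarith
      calc _ ≤ 1 * ∫⁻ t in Set.Ioc (-r) r, ‖F (x - t)‖ₑ := by
            gcongr
            exact enorm_intervalIntegral_mul_exp_le F _ x (by linarith)
        _ ≤ 1 * N := by
            gcongr
            refine (setLIntegral_le_lintegral _ _).trans ?_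
            rw [lintegral_sub_left_eq_self (μ := volume) (fun y => ‖F y‖ₑ) x]
            exact lintegral_enorm_le_of_weight hN
        _ ≤ _ := by
            gcongr
            · rwa [ENNReal.one_le_ofReal]
            · exact le_self_add
    have hx4 : 4 < x := (le_max_left _ _).trans_lt hxR
    have hxR2 : R ≤ x / 2 := by
      have := (le_max_right 4 (2 * R)).trans_lt hxR
      linarith
    have hscale : ∀ q : ℝ, 0 ≤ q → q ≤ 2 → (x / 2) ^ (-q) ≤ 16 * (1 + x) ^ (-q) := by
      intro q hq0 hq2
      have h4 : (1 + x) / 4 ≤ x / 2 := by linarith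
      calc (x / 2) ^ (-q) ≤ ((1 + x) / 4) ^ (-q) :=
            Real.rpow_le_rpow_of_nonpos (by positivity) h4 (by linarith)
        _ = 4 ^ q * (1 + x) ^ (-q) := by
            rw [Real.div_rpow (by positivity) (by norm_num), Real.rpow_neg (x := 4) (by norm_num)]
            field_simp
        _ ≤ 16 * (1 + x) ^ (-q) := by
            gcongr
            calc (4 : ℝ) ^ q ≤ 4 ^ (2 : ℝ) := Real.rpow_le_rpow_of_exponent_le (by norm_num) hq2
              _ = 16 := by norm_num
    rcases le_total r (x / 2) with hrx | hrx
    · refine (average_le_of_le_half (by linarith) hN _ hr hrx).trans ?_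
      gcongr
      · refine (hscale l (by linarith) hl2.le).trans ?_
        gcongr
        · rw [hM]
          nlinarith
        · linarith
      · exact le_self_add
    · refine (average_le_of_half_le (φ := fun t => ∑ j, c j * |t| ^ d j)
        (φ₁ := fun t => ∑ j, c j * d j * t ^ (d j - 1))
        (φ₂ := fun t => ∑ j, c j * d j * (d j - 1) * t ^ (d j - 1 - 1))
        hl.le hF hk hN hx4.le hrx hK.le
        (fun t ht => hasDerivAt_sum_mul_abs_rpow c d (by linarith))
        (fun t ht => hasDerivAt_sum_mul_rpow (fun j => c j * d j) (fun j => d j - 1) (by linarith))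
        ?_ (fun t ht => (hphase c hc hcl t (hxR2.trans ht)).1)
        (fun t ht => (hphase c hc hcl t (hxR2.trans ht)).2)).trans ?_
      · refine continuousOn_finsetSum _ fun j _ => continuousOn_const.mul ?_
        refine continuousOn_id.rpow_const fun t ht => Or.inl ?_
        have : x / 2 ≤ t := ht
        simp only [id]
        linarith
      · gcongr ENNReal.ofReal ?_ * _
        have h5 : x ^ (-(3 / 2) : ℝ) ≤ (x / 2) ^ (-(3 / 2) : ℝ) :=
          Real.rpow_le_rpow_of_nonpos (by linarith) (by linarith) (by norm_num)
        have h6 := hscale (3 / 2) (by norm_num) (by norm_num)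
        calc (1 + 14 * K) * x ^ (-(3 / 2) : ℝ)
            ≤ (1 + 14 * K) * (16 * (1 + x) ^ (-(3 / 2) : ℝ)) := by
              gcongr
              exact h5.trans h6
          _ = 16 * (1 + 14 * K) * (1 + x) ^ (-(3 / 2) : ℝ) := by ring
          _ ≤ _ := by
              gcongr
              · rw [hM]
                linarith
              · linarith
  refine ⟨M, hM0, fun c hc hcl F k g N Λ hF hk hN x r hr => ?_⟩
  rcases le_total 0 x with hx | hx
  · rw [abs_of_nonneg hx]
    exact key c hc hcl F k g N Λ hF hk hN x r hx hr
  · -- The phase is even, so reflecting `F` reduces negative centres to positive ones.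
    rw [abs_of_nonpos hx]
    have h7 := key c hc hcl (fun t => F (0 - t)) _ _ N Λ (hF.comp_sub 0) (hk.comp_sub 0)
      ((lintegral_weight_comp_neg F l).trans_le hN) (-x) r (by linarith) hr
    have h8 : ∫ t in (-r)..r, F (x - t) *
        Complex.exp (Complex.I * ((∑ j, c j * |t| ^ d j : ℝ) : ℂ))
        = ∫ t in (-r)..r, F (0 - (-x - t)) *
        Complex.exp (Complex.I * ((∑ j, c j * |t| ^ d j : ℝ) : ℂ)) := by
      have h9 := intervalIntegral.integral_comp_neg (a := -r) (b := r) fun t => F (x - t) *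
        Complex.exp (Complex.I * ((∑ j, c j * |t| ^ d j : ℝ) : ℂ))
      rw [neg_neg] at h9
      rw [← h9]
      congr 1
      funext t
      rw [abs_neg]
      congr 2
      ring
    rw [h8]
    exact h7

/-! ### Averages over short intervals -/

/-- Radii up to `1`: the average is bounded by the local supremum. -/
theorem average_le_of_forall_le {F : ℝ → ℂ} (φ : ℝ → ℝ) {x r : ℝ} (hr : 0 < r) (hr1 : r ≤ 1)
    {S : ℝ≥0∞} (hS : ∀ y, |y - x| ≤ 1 → ‖F y‖ₑ ≤ S) :
    ENNReal.ofReal (1 / (2 * r)) *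
      ‖∫ t in (-r)..r, F (x - t) * Complex.exp (Complex.I * (φ t : ℂ))‖ₑ ≤ S := by
  calc _ ≤ ENNReal.ofReal (1 / (2 * r)) * ∫⁻ t in Set.Ioc (-r) r, S := by
        gcongr
        refine (enorm_intervalIntegral_mul_exp_le F φ x hr.le).trans ?_
        refine setLIntegral_mono' measurableSet_Ioc fun t ht => hS _ ?_
        rw [abs_le]
        constructor <;> linarith [ht.1, ht.2]
    _ = ENNReal.ofReal (1 / (2 * r) * (r - -r)) * S := by
        rw [setLIntegral_const, Real.volume_Ioc, ENNReal.ofReal_mul (by positivity)]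
        ring
    _ = S := by
        have : 1 / (2 * r) * (r - -r) = 1 := by
          field_simp
          ring
        rw [this, ENNReal.ofReal_one, one_mul]

/-- The weight `(1 + |x|)^l` varies by a bounded factor over intervals of bounded length. -/
theorem weight_le_of_abs_sub_le {l x y : ℝ} (hl0 : 0 ≤ l) (hl2 : l ≤ 2) (h : |x - y| ≤ 2) :
    (1 + |x|) ^ l ≤ 36 * (1 + |y| ^ l) := by
  have hxy : |x| ≤ |y| + 2 := by
    have := abs_sub_abs_le_abs_sub x y
    linarith
  have h1 : 1 + |x| ≤ 6 * max 1 |y| := by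
    have := le_max_left 1 |y|
    have := le_max_right 1 |y|
    linarith
  calc (1 + |x|) ^ l ≤ (6 * max 1 |y|) ^ l := by gcongr
    _ = 6 ^ l * (max 1 |y|) ^ l := Real.mul_rpow (by norm_num) (by positivity)
    _ ≤ 36 * (1 + |y| ^ l) := by
      gcongr
      · calc (6 : ℝ) ^ l ≤ 6 ^ (2 : ℝ) := Real.rpow_le_rpow_of_exponent_le (by norm_num) hl2
          _ = 36 := by norm_num
      · rcases max_cases 1 |y| with ⟨h2, _⟩ | ⟨h2, _⟩
        · rw [h2, Real.one_rpow]
          have : 0 ≤ |y| ^ l := by positivity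
          linarith
        · rw [h2]
          linarith

/-- Averaging over an interval of length `(1 + |x|)^{-l}` balances the weighted `L¹` norm of `F`
against the bounded part of `F'`. -/
theorem IsPrimitive.enorm_le_local {F k : ℝ → ℂ} {g : ℝ → ℝ≥0∞} {Λ : ℝ≥0∞} {l : ℝ}
    (hl0 : 0 ≤ l) (hl2 : l ≤ 2) (h : IsPrimitive F k) (hk : DominatedBy k g Λ) {x y : ℝ}
    (hxy : |y - x| ≤ 1) :
    ‖F y‖ₑ ≤ (∫⁻ z in Set.Icc (x - 2) (x + 2),
        (36 * (ENNReal.ofReal (1 + |z| ^ l) * ‖F z‖ₑ) + g z))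
      + Λ * ENNReal.ofReal ((1 + |x|) ^ (-l)) := by
  have h1x : 1 ≤ 1 + |x| := by linarith [abs_nonneg x]
  have hδ1 : (1 + |x|) ^ (-l) ≤ 1 := Real.rpow_le_one_of_one_le_of_nonpos h1x (by linarith)
  refine (h.enorm_le_of_abs_sub_le hk (δ := (1 + |x|) ^ (-l)) (by positivity) hδ1 hxy).trans ?_
  gcongr
  have hw : Measurable fun z => 36 * (ENNReal.ofReal (1 + |z| ^ l) * ‖F z‖ₑ) := by
    have := h.continuous.measurable
    fun_prop
  rw [lintegral_add_left hw, ← Real.rpow_neg (by positivity), neg_neg,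
    ← lintegral_const_mul' _ _ ENNReal.ofReal_ne_top]
  gcongr ?_ + _
  refine setLIntegral_mono' measurableSet_Icc fun z hz => ?_
  rw [← mul_assoc]
  gcongr
  rw [← ENNReal.ofReal_ofNat, ← ENNReal.ofReal_mul (by norm_num)]
  apply ENNReal.ofReal_le_ofReal
  apply weight_le_of_abs_sub_le hl0 hl2
  rw [abs_le]
  constructor <;> linarith [hz.1, hz.2]

theorem lintegral_setLIntegral_Icc {a : ℝ → ℝ≥0∞} (ha : AEMeasurable a volume) :
    ∫⁻ x, ∫⁻ z in Set.Icc (x - 2) (x + 2), a z = 4 * ∫⁻ z, a z := by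
  have hS : MeasurableSet {q : ℝ × ℝ | q.2 ∈ Set.Icc (q.1 - 2) (q.1 + 2)} :=
    (measurableSet_le (measurable_fst.sub_const 2) measurable_snd).inter
      (measurableSet_le measurable_snd (measurable_fst.add_const 2))
  have h1 : ∀ x, ∫⁻ z in Set.Icc (x - 2) (x + 2), a z
      = ∫⁻ z, {q : ℝ × ℝ | q.2 ∈ Set.Icc (q.1 - 2) (q.1 + 2)}.indicator (fun q => a q.2) (x, z) := by
    intro x
    rw [← lintegral_indicator measurableSet_Icc]
    rfl
  have h2 : ∀ x z,
      {q : ℝ × ℝ | q.2 ∈ Set.Icc (q.1 - 2) (q.1 + 2)}.indicator (fun q => a q.2) (x, z)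
      = (Set.Icc (z - 2) (z + 2)).indicator (fun _ => a z) x := by
    intro x z
    simp only [Set.indicator_apply, Set.mem_ofPred_eq, Set.mem_Icc]
    congr 1
    simp only [eq_iff_iff]
    constructor <;> rintro ⟨h3, h4⟩ <;> constructor <;> linarith
  simp only [h1]
  rw [lintegral_lintegral_swap
    (f := fun x z => {q : ℝ × ℝ | q.2 ∈ Set.Icc (q.1 - 2) (q.1 + 2)}.indicator
      (fun q => a q.2) (x, z)) (AEMeasurable.indicator ha.comp_snd hS)]
  simp only [h2]
  rw [← lintegral_const_mul'' _ ha]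
  congr 1
  funext z
  rw [lintegral_indicator measurableSet_Icc, setLIntegral_const, Real.volume_Icc, mul_comm]
  congr 1
  rw [← ENNReal.ofReal_ofNat]
  congr 1
  ring

/-! ### Measurability of the maximal function -/

theorem oscMaximal_congr_ae (γ : ℝ → ℝ → ℝ) {f F : ℝ → ℂ} (h : f =ᵐ[volume] F) :
    oscMaximal γ f = oscMaximal γ F := by
  funext x
  unfold oscMaximal
  refine iSup_congr fun r => iSup_congr fun _ => ?_
  congr 2
  apply intervalIntegral.integral_congr_ae
  filter_upwards [(Measure.measurePreserving_sub_left volume x).quasiMeasurePreserving.ae_eq h]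
    with t ht _
  have : f (x - t) = F (x - t) := ht
  rw [this]

/-- The averages depend continuously on the radius, so rational radii give the same supremum. -/
theorem measurable_oscMaximal {γ : ℝ → ℝ → ℝ} (hγ : Measurable (Function.uncurry γ)) {F : ℝ → ℂ}
    (hF : Continuous F) : Measurable (oscMaximal γ F) := by
  set E : ℝ → ℝ → ℂ := fun x t => F (x - t) * Complex.exp (Complex.I * (γ x t : ℂ)) with hE
  have hEm : Measurable (Function.uncurry E) := by
    have h1 : Measurable fun q : ℝ × ℝ => F (q.1 - q.2) := by
      have := hF.measurable
      fun_prop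
    have h2 : Measurable fun q : ℝ × ℝ => Complex.exp (Complex.I * (γ q.1 q.2 : ℂ)) :=
      Complex.measurable_exp.comp ((Complex.measurable_ofReal.comp hγ).const_mul Complex.I)
    exact h1.mul h2
  have hii : ∀ x a b, IntervalIntegrable (E x) volume a b := by
    intro x a b
    have h1 : IntervalIntegrable (fun t => F (x - t)) volume a b :=
      (hF.comp (continuous_const.sub continuous_id)).intervalIntegrable a b
    refine h1.mono_fun (hEm.comp measurable_prodMk_left).aestronglyMeasurable ?_
    refine Filter.Eventually.of_forall fun t => le_of_eq ?_
    simp only [hE, norm_mul]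
    rw [mul_comm Complex.I, Complex.norm_exp_ofReal_mul_I, mul_one]
  set Φ : ℝ → ℝ → ℝ≥0∞ := fun r x =>
    ENNReal.ofReal (1 / (2 * r)) * ‖∫ t in (-r)..r, E x t‖ₑ with hΦ
  have hΦm : ∀ r, Measurable (Φ r) := by
    intro r
    have h1 : ∀ s : Set ℝ, Measurable fun x => ∫ t in s, E x t := fun s =>
      (hEm.stronglyMeasurable.integral_prod_right (ν := volume.restrict s)).measurable
    have h2 : Measurable fun x => ∫ t in (-r)..r, E x t := by
      simp only [intervalIntegral]
      exact (h1 _).sub (h1 _)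
    exact h2.enorm.const_mul _
  have hΦc : ∀ x, ContinuousOn (fun r => Φ r x) (Set.Ioi 0) := by
    intro x
    have h1 : Continuous fun r => ∫ t in (0 : ℝ)..r, E x t :=
      intervalIntegral.continuous_primitive (hii x) 0
    have h2 : Continuous fun r => ∫ t in (-r)..r, E x t := by
      have h3 : (fun r => ∫ t in (-r)..r, E x t)
          = fun r => (∫ t in (0 : ℝ)..r, E x t) - ∫ t in (0 : ℝ)..(-r), E x t := by
        funext r
        rw [intervalIntegral.integral_interval_sub_left (hii x _ _) (hii x _ _)]
      rw [h3]
      exact h1.sub (h1.comp continuous_neg)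
    have h4 : ContinuousOn (fun r : ℝ => ENNReal.ofReal (1 / (2 * r))) (Set.Ioi 0) := by
      refine ENNReal.continuous_ofReal.comp_continuousOn (continuousOn_const.div (by fun_prop) ?_)
      intro r hr
      have : (0 : ℝ) < r := hr
      positivity
    exact h4.ennreal_mul h2.enorm.continuousOn (fun _ _ => Or.inr enorm_ne_top)
      fun _ _ => Or.inr ENNReal.ofReal_ne_top
  have hsup : oscMaximal γ F = fun x => ⨆ (q : ℚ) (_ : (0 : ℝ) < q), Φ q x := by
    funext x
    apply le_antisymm
    · refine iSup₂_le fun r hr => ?_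
      have hcl : r ∈ closure (Set.Ioi (0 : ℝ) ∩ Set.range ((↑) : ℚ → ℝ)) :=
        Rat.denseRange_cast.open_subset_closure_inter isOpen_Ioi hr
      have hmaps : Set.MapsTo (fun r => Φ r x) (Set.Ioi (0 : ℝ) ∩ Set.range ((↑) : ℚ → ℝ))
          (Set.Iic (⨆ (q : ℚ) (_ : (0 : ℝ) < q), Φ q x)) := by
        rintro _ ⟨hq, q, rfl⟩
        exact le_iSup₂ (f := fun (q : ℚ) (_ : (0 : ℝ) < q) => Φ q x) q hq
      have := (((hΦc x) r hr).mono Set.inter_subset_left).mem_closure hcl hmaps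
      rwa [isClosed_Iic.closure_eq] at this
    · exact iSup₂_le fun q hq => le_iSup₂_of_le (q : ℝ) hq le_rfl
  rw [hsup]
  exact Measurable.iSup fun q => Measurable.iSup fun _ => hΦm q

/-! ### Integration of the pointwise bounds -/

/-- `γ(x, t) = ∑ c_j(x) |t|^{d_j}` with exponents `2 ≤ d_0 < ⋯ < d_m`, the coefficients being bounded
by `A` and the last one bounded below by `A⁻¹`. This covers both kinds of phases. -/
def IsBoundedPowerSum (γ : ℝ → ℝ → ℝ) {m : ℕ} (c : Fin (m + 1) → ℝ → ℝ) (d : Fin (m + 1) → ℝ)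
    (A : ℝ) : Prop :=
  (∀ x t, γ x t = ∑ j, c j x * |t| ^ d j) ∧ (∀ j, AEStronglyMeasurable (c j) volume) ∧
    (∀ᵐ x, (∀ j, |c j x| ≤ A) ∧ A⁻¹ ≤ |c (Fin.last m) x|) ∧ 0 < A ∧ 2 ≤ d 0 ∧ StrictMono d

theorem MeasureTheory.MemLp.exists_ae_abs_le {c : ℝ → ℝ} (h : MemLp c ∞ volume) :
    ∃ A, ∀ᵐ x, |c x| ≤ A := by
  refine ⟨(eLpNorm c ∞ volume).toReal, ?_⟩
  filter_upwards [ae_le_eLpNormEssSup (f := c) (μ := volume)] with x hx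
  rw [← eLpNorm_exponent_top] at hx
  have := ENNReal.toReal_mono h.2.ne hx
  rwa [toReal_enorm, Real.norm_eq_abs] at this

theorem exists_isBoundedPowerSum {γ : ℝ → ℝ → ℝ} {m : ℕ} {c : Fin (m + 1) → ℝ → ℝ}
    {d : Fin (m + 1) → ℝ} (hγ : ∀ x t, γ x t = ∑ j, c j x * |t| ^ d j)
    (hc : ∀ j, MemLp (c j) ∞ volume) (hcl : BddWithInverse (c (Fin.last m))) (hd0 : 2 ≤ d 0)
    (hd : StrictMono d) : ∃ A, IsBoundedPowerSum γ c d A := by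
  choose B hB using fun j => (hc j).exists_ae_abs_le
  obtain ⟨B', hB'⟩ := hcl.memLp_inv.exists_ae_abs_le
  set A := 1 + |B'| + ∑ j, |B j| with hA
  have hsum : ∀ j, |B j| ≤ ∑ j, |B j| := fun j =>
    Finset.single_le_sum (fun i _ => abs_nonneg (B i)) (Finset.mem_univ j)
  have hsum0 : 0 ≤ ∑ j, |B j| := Finset.sum_nonneg fun j _ => abs_nonneg _
  have hA0 : 0 < A := by positivity
  refine ⟨A, hγ, fun j => (hc j).1, ?_, hA0, hd0, hd⟩
  filter_upwards [ae_all_iff.2 hB, hB', hcl.ne_zero] with x h1 h2 h3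
  constructor
  · intro j
    linarith [h1 j, le_abs_self (B j), hsum j, abs_nonneg B']
  · rw [inv_le_comm₀ hA0 (abs_pos.2 h3), ← abs_inv, ← one_div]
    linarith [le_abs_self B']

/-- Both kinds of phases are power sums; the quadratic one has the single exponent `2`. -/
theorem exists_isBoundedPowerSum_of_phase {γ : ℝ → ℝ → ℝ}
    (h : IsPowerSumPhase γ ∨ IsQuadraticPhase γ) :
    ∃ (m : ℕ) (c : Fin (m + 1) → ℝ → ℝ) (d : Fin (m + 1) → ℝ) (A : ℝ),
      IsBoundedPowerSum γ c d A := by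
  rcases h with ⟨m, c, d, hγ, hc, hcl, hd0, hd, -⟩ | ⟨a, hγ, ha⟩
  · exact ⟨m, c, d, exists_isBoundedPowerSum hγ hc hcl hd0 hd⟩
  · have : Subsingleton (Fin (0 + 1)) := inferInstanceAs (Subsingleton (Fin 1))
    refine ⟨0, fun _ => a, fun _ => 2, exists_isBoundedPowerSum (fun x t => ?_) (fun _ => ha.memLp)
      ha le_rfl (Subsingleton.strictMono _)⟩
    simp [hγ]

theorem IsBoundedPowerSum.aemeasurable_oscMaximal {γ : ℝ → ℝ → ℝ} {m : ℕ}
    {c : Fin (m + 1) → ℝ → ℝ} {d : Fin (m + 1) → ℝ} {A : ℝ} (h : IsBoundedPowerSum γ c d A)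
    {F : ℝ → ℂ} (hF : Continuous F) : AEMeasurable (oscMaximal γ F) volume := by
  obtain ⟨hγ, hc, -⟩ := h
  set γ' : ℝ → ℝ → ℝ := fun x t => ∑ j, (hc j).mk (c j) x * |t| ^ d j with hγ'
  have hm : Measurable (Function.uncurry γ') := by
    refine Finset.measurable_fun_sum _ fun j _ => ?_
    refine ((hc j).stronglyMeasurable_mk.measurable.comp measurable_fst).mul ?_
    fun_prop
  refine ⟨oscMaximal γ' F, measurable_oscMaximal hm hF, ?_⟩
  filter_upwards [ae_all_iff.2 fun j => (hc j).ae_eq_mk] with x hx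
  have : γ x = γ' x := by
    funext t
    simp only [hγ, hγ', hx]
  simp only [oscMaximal, this]

/-- The case of functions given with a continuous representative. -/
theorem IsBoundedPowerSum.exists_lintegral_oscMaximal_le {γ : ℝ → ℝ → ℝ} {m : ℕ}
    {c : Fin (m + 1) → ℝ → ℝ} {d : Fin (m + 1) → ℝ} {A : ℝ} (h : IsBoundedPowerSum γ c d A)
    {l : ℝ} (hl : 1 < l) (hl2 : l < 2) :
    ∃ C : ℝ≥0, ∀ (F k : ℝ → ℂ) (g : ℝ → ℝ≥0∞) (Λ : ℝ≥0∞), IsPrimitive F k → DominatedBy k g Λ →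
      ∫⁻ x, oscMaximal γ F x ≤ C * ((∫⁻ y, ENNReal.ofReal (1 + |y| ^ l) * ‖F y‖ₑ) + Λ) := by
  obtain ⟨hγ, -, hbd, hA, hd0, hd⟩ := h
  obtain ⟨K, hK, havg⟩ := exists_average_bound d hd0 hd hA hl hl2
  have hfin : ∀ q : ℝ, 1 < q → ∫⁻ x : ℝ, ENNReal.ofReal ((1 + |x|) ^ (-q)) ≠ ∞ := fun q hq =>
    (finite_integral_one_add_norm (E := ℝ) (μ := volume) (by simpa using hq)).ne
  have hmeas : ∀ q : ℝ, Measurable fun x : ℝ => ENNReal.ofReal ((1 + |x|) ^ (-q)) := fun q => by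
    fun_prop
  set J₁ := ∫⁻ x : ℝ, ENNReal.ofReal ((1 + |x|) ^ (-l)) with hJ₁
  set J₂ := ∫⁻ x : ℝ, ENNReal.ofReal ((1 + |x|) ^ (-(3 / 2) : ℝ)) with hJ₂
  have hJ₁t : J₁ ≠ ∞ := hfin l hl
  have hJ₂t : J₂ ≠ ∞ := hfin (3 / 2) (by norm_num)
  -- `148 = 4 * 36 + 4`: intervals of length `4`, and the weight comparison with factor `36`.
  have hCt : 148 + J₁ + ENNReal.ofReal K * (J₁ + J₂) ≠ ∞ := by finiteness
  refine ⟨(148 + J₁ + ENNReal.ofReal K * (J₁ + J₂)).toNNReal, fun F k g Λ hF hk => ?_⟩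
  rw [ENNReal.coe_toNNReal hCt]
  set N := ∫⁻ y, ENNReal.ofReal (1 + |y| ^ l) * ‖F y‖ₑ with hN
  set a : ℝ → ℝ≥0∞ := fun z => 36 * (ENNReal.ofReal (1 + |z| ^ l) * ‖F z‖ₑ) + g z with ha
  have hFm := hF.continuous.measurable
  have hw : Measurable fun z => ENNReal.ofReal (1 + |z| ^ l) * ‖F z‖ₑ := by fun_prop
  have ham : AEMeasurable a volume := (hw.const_mul 36).aemeasurable.add hk.aemeasurable
  have haint : ∫⁻ z, a z ≤ 36 * N + Λ := by
    rw [ha, lintegral_add_left (hw.const_mul 36), lintegral_const_mul _ hw]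
    gcongr
    exact hk.lintegral_le
  have hpt : ∀ᵐ x, oscMaximal γ F x ≤ (∫⁻ z in Set.Icc (x - 2) (x + 2), a z)
      + (Λ * ENNReal.ofReal ((1 + |x|) ^ (-l)) + ENNReal.ofReal K * (N + Λ) *
        (ENNReal.ofReal ((1 + |x|) ^ (-l)) + ENNReal.ofReal ((1 + |x|) ^ (-(3 / 2) : ℝ)))) := by
    filter_upwards [hbd] with x hx
    refine iSup₂_le fun r hr => ?_
    rcases le_total r 1 with hr1 | hr1
    · refine (average_le_of_forall_le (γ x) hr hr1
        (fun y hy => hF.enorm_le_local (by linarith) hl2.le hk hy)).trans ?_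
      rw [← add_assoc]
      exact le_self_add
    · have h1 := havg (fun j => c j x) hx.1 hx.2 F k g N Λ hF hk le_rfl x r hr1
      simp only [← hγ] at h1
      refine h1.trans ?_
      rw [ENNReal.ofReal_mul hK, ENNReal.ofReal_add (by positivity) (by positivity)]
      calc _ = ENNReal.ofReal K * (N + Λ) * (ENNReal.ofReal ((1 + |x|) ^ (-l))
            + ENNReal.ofReal ((1 + |x|) ^ (-(3 / 2) : ℝ))) := by ring
        _ ≤ _ := le_add_self.trans le_add_self
  have hm1 : Measurable fun x : ℝ => ENNReal.ofReal ((1 + |x|) ^ (-l))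
      + ENNReal.ofReal ((1 + |x|) ^ (-(3 / 2) : ℝ)) := (hmeas l).add (hmeas (3 / 2))
  have hm2 : Measurable fun x : ℝ => Λ * ENNReal.ofReal ((1 + |x|) ^ (-l))
      + ENNReal.ofReal K * (N + Λ) * (ENNReal.ofReal ((1 + |x|) ^ (-l))
        + ENNReal.ofReal ((1 + |x|) ^ (-(3 / 2) : ℝ))) :=
    ((hmeas l).const_mul Λ).add (hm1.const_mul _)
  calc ∫⁻ x, oscMaximal γ F x ≤ _ := lintegral_mono_ae hpt
    _ = 4 * (∫⁻ z, a z) + (Λ * J₁ + ENNReal.ofReal K * (N + Λ) * (J₁ + J₂)) := by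
        rw [lintegral_add_right _ hm2,
          lintegral_setLIntegral_Icc ham, lintegral_add_right _ (hm1.const_mul _),
          lintegral_const_mul _ (hmeas l), lintegral_const_mul _ hm1,
          lintegral_add_left (hmeas l)]
    _ ≤ 4 * (36 * (N + Λ) + (N + Λ)) + ((N + Λ) * J₁ + ENNReal.ofReal K * (N + Λ) * (J₁ + J₂)) := by
        gcongr
        · refine haint.trans ?_
          gcongr
          · exact le_self_add
          · exact le_add_self
        · exact le_add_self
    _ = _ := by ring

theorem theorem2 (γ : ℝ → ℝ → ℝ) (p : ℝ≥0∞) (l : ℝ) (hl1 : 1 < l) (hl2 : l < 2)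
    (h : (IsPowerSumPhase γ ∧ 1 ≤ p) ∨ (IsQuadraticPhase γ ∧ 1 ≤ p ∧ p < ∞)) :
    ∃ C : ℝ≥0, ∀ f f' : ℝ → ℂ, MemCpl p l f f' →
      MemLp (oscMaximal γ f) 1 volume ∧
      eLpNorm (oscMaximal γ f) 1 volume ≤ C * normCpl p l f f' := by
  have hp : 1 ≤ p := h.elim (fun h => h.2) (fun h => h.2.1)
  obtain ⟨m, c, d, A, hγ⟩ := exists_isBoundedPowerSum_of_phase
    (h.imp (fun h => h.1) (fun h => h.1))
  obtain ⟨C, hC⟩ := hγ.exists_lintegral_oscMaximal_le hl1 hl2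
  refine ⟨C, fun f f' hf => ?_⟩
  obtain ⟨F, hF, hfF⟩ := hf.hasWeakDeriv.exists_isPrimitive
  obtain ⟨g, hg⟩ := hf.memLp_deriv.exists_dominatedBy hp
  have hnorm : normCpl p l f f'
      = (∫⁻ y, ENNReal.ofReal (1 + |y| ^ l) * ‖F y‖ₑ) + eLpNorm f' p volume := by
    rw [normCpl, eLpNorm_one_eq_lintegral_enorm]
    congr 1
    refine lintegral_congr_ae ?_
    filter_upwards [hfF] with y hy
    rw [hy, enorm_mul, ← ofReal_norm, Complex.norm_real, Real.norm_of_nonneg (by positivity)]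
  have hle : eLpNorm (oscMaximal γ f) 1 volume ≤ C * normCpl p l f f' := by
    rw [oscMaximal_congr_ae γ hfF, eLpNorm_one_eq_lintegral_enorm, hnorm]
    exact hC F f' g _ hF hg
  refine ⟨⟨?_, hle.trans_lt ?_⟩, hle⟩
  · rw [oscMaximal_congr_ae γ hfF]
    exact (hγ.aemeasurable_oscMaximal hF.continuous).aestronglyMeasurable
  · exact ENNReal.mul_lt_top ENNReal.coe_lt_top
      (ENNReal.add_lt_top.2 ⟨hf.memLp_weight.2, hf.memLp_deriv.2⟩)
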